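/- Let $n\ge 1$, let $A\in\mathbb{R}^{n\times n}$ have rational (in particular, possibly integer) entries, and let $p\in\{1,\dots,n\}$. For $x\in\mathbb{R}^n$ let $A\otimes_\omega x\in\mathbb{R}^n$, $\omega=p/n$, be the vector whose $i$-th component is the $p$-th smallest (counted with repetitions) of the numbers $A(i,1)+x_1,\dots,A(i,n)+x_n$. Call $x\in\mathbb{R}^n$ a finite eigenvector if $A\otimes_\omega x=\lambda+x$ (with $\lambda$ added to every component) for some $\lambda\in\mathbb{R}$. For $D\in(\mathbb{R}\cup\{-\infty\})^{n\times n}$ and $a,b\in\mathbb{R}^n$ put $$\mathtt{MinMaxValue}(D,a,b\mid p,n+1-p):=\min_{S_1,S_2}\ \max_{i\in S_1,\,j\in S_2}\bigl(D(i,j)+a_i-b_j\bigr),$$ where the minimum is over all subsets $S_1,S_2\subseteq\{1,\dots,n\}$ with $|S_1|=p$ and $|S_2|=n+1-p$. Let $D_p^0$ be the max-plus identity matrix ($0$ on the diagonal, $-\infty$ elsewhere) and, for $k\ge 0$ and all $i,j$, $$D_p^{k+1}(i,j):=\mathtt{MinMaxValue}(D_p^k,A_i,A_j\mid p,n+1-p),$$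 where $A_i$ is the $i$-th row of $A$. Then: 1. the sequence is increasing: $D_p^k\le D_p^{k+1}$ entrywise for all $k\ge 0$; 2. $A$ has a finite eigenvector, and every finite eigenvector $x$ gives an upper bound: $D_p^k(i,j)\le D_x(i,j):=x_i-x_j$ for all $k\ge 0$ and all $i,j$; 3. the sequence stabilizes after finitely many steps: there is $K$ such that $D_p^k=D_p^K$ for all $k\ge K$. -/

import Mathlib

noncomputable section

namespace MaxminOmega

/-- The `p`-th smallest element (with repetitions, `1 ≤ p ≤ n`) of a family `s` of `n` real numbers,
i.e. the maxmin-`ω` operation with `ω = p / n`. Here `s ∘ Tuple.sort s` is the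
nondecreasing rearrangement of `s`, with indices starting at `0`. -/
def omegaSum {n : ℕ} (p : ℕ) (h1 : 1 ≤ p) (hn : p ≤ n) (s : Fin n → ℝ) : ℝ :=
  s (Tuple.sort s ⟨p - 1, by omega⟩)

/-- The maxmin-`ω` matrix-vector product with `ω = p / n`. -/
def omegaMulVec {n : ℕ} (p : ℕ) (h1 : 1 ≤ p) (hn : p ≤ n)
    (A : Matrix (Fin n) (Fin n) ℝ) (x : Fin n → ℝ) : Fin n → ℝ :=
  fun i => omegaSum p h1 hn (fun j => A i j + x j)

/-- `x ∈ ℝⁿ` is a (finite) maxmin-`ω` eigenvector of `A`, `ω = p / n`, for the eigenvalue `μ`. -/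
def IsEigenvector {n : ℕ} (p : ℕ) (h1 : 1 ≤ p) (hn : p ≤ n)
    (A : Matrix (Fin n) (Fin n) ℝ) (μ : ℝ) (x : Fin n → ℝ) : Prop :=
  ∀ i, omegaMulVec p h1 hn A x i = μ + x i

theorem powersetCard_univ_nonempty {n r : ℕ} (hr : r ≤ n) :
    (Finset.powersetCard r (Finset.univ : Finset (Fin n))).Nonempty :=
  Finset.powersetCard_nonempty.2 (by simpa using hr)

/-- `MinMaxValue(D, a, b | r, s)`: the minimum, over all `r`-element subsets `S₁` and
`s`-element subsets `S₂` of the index set, of the maximum of `D(i,j) + a_i - b_j` over `i ∈ S₁`,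
`j ∈ S₂`. The set `ℝ ∪ {-∞}` is `WithBot ℝ`, so `Finset.sup` is the maximum. -/
def minMaxValue {n : ℕ} (D : Matrix (Fin n) (Fin n) (WithBot ℝ)) (a b : Fin n → ℝ)
    (r s : ℕ) (hr : r ≤ n) (hs : s ≤ n) : WithBot ℝ :=
  (Finset.powersetCard r (Finset.univ : Finset (Fin n)) ×ˢ
      Finset.powersetCard s (Finset.univ : Finset (Fin n))).inf'
    ((powersetCard_univ_nonempty hr).product (powersetCard_univ_nonempty hs))
    (fun S => (S.1 ×ˢ S.2).sup (fun ij => D ij.1 ij.2 + ((a ij.1 - b ij.2 : ℝ) : WithBot ℝ)))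

/-- The max-plus identity matrix. -/
def maxPlusOne (n : ℕ) : Matrix (Fin n) (Fin n) (WithBot ℝ) :=
  Matrix.of fun i j => if i = j then ((0 : ℝ) : WithBot ℝ) else ⊥

/-- The sequence of difference bound matrices `D_p^k`, `k = 0, 1, 2, …`. -/
def dbmSeq {n : ℕ} (A : Matrix (Fin n) (Fin n) ℝ) (p : ℕ) (h1 : 1 ≤ p) (hn : p ≤ n) :
    ℕ → Matrix (Fin n) (Fin n) (WithBot ℝ)
  | 0 => maxPlusOne n
  | k + 1 => Matrix.of fun i j =>
      minMaxValue (dbmSeq A p h1 hn k) (A i) (A j) p (n + 1 - p) hn (by omega)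

/-- The matrix `D_x(i,j) = x_i - x_j`. -/
def dbmOfVec {n : ℕ} (x : Fin n → ℝ) : Matrix (Fin n) (Fin n) (WithBot ℝ) :=
  Matrix.of fun i j => ((x i - x j : ℝ) : WithBot ℝ)

end MaxminOmega

end

/-!
Every part rests on one description of the `p`-th smallest element `ω(s)` of a family `s` of `n`
reals: some `p` indices have `s j ≤ ω(s)` and some `n + 1 - p` indices have `ω(s) ≤ s j`
(`exists_card_le_omegaSum`, `exists_card_omegaSum_le`), whereas a `p`-set and an `(n + 1 - p)`-set
of indices always meet (`exists_mem_inter`).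

*Monotonicity.* As `S₁` and `S₂` meet, each maximum in the definition of `D¹(i,i)` includes
a term `0`, so `D⁰ ≤ D¹`; `minMaxValue` is monotone in the matrix, and induction does the rest.

*Existence of an eigenvector.* The map `f(x) = A ⊗ x` is sup-norm nonexpansive, commutes with adding
constants, and its image has bounded spread: `f(x)ᵢ - f(x)ₖ ≤ maxⱼ (A i j - A k j)`. For `α < 1` the
contraction `x ↦ f(α x)` has a fixed point `x_α`. Normalised to vanish at one coordinate, `x_α`
stays in a compact box, and any limit point for `α → 1` is an eigenvector
(`exists_isEigenvector`).

*Upper bound.* If `x` is an eigenvector, then taking for `S₁` and `S₂` the index sets above for the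
families `A i · + x` and `A j · + x` gives `minMaxValue(D_x, A_i, A_j) ≤ D_x(i,j)`, so `D_x` bounds
the whole sequence.

*Stabilisation.* With `N` a common denominator of `A`, all entries of all `Dᵏ` lie in
`{-∞} ∪ N⁻¹ℤ`; an increasing sequence in this set that is bounded above is eventually constant.
-/

namespace MaxminOmega

/-! ### The `p`-th smallest element -/

theorem exists_card_le_omegaSum {n p : ℕ} (h1 : 1 ≤ p) (hn : p ≤ n) (s : Fin n → ℝ) :
    ∃ S : Finset (Fin n), S.card = p ∧ ∀ j ∈ S, s j ≤ omegaSum p h1 hn s := by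
  refine ⟨(Finset.Iic (⟨p - 1, by omega⟩ : Fin n)).map (Tuple.sort s).toEmbedding, ?_, ?_⟩
  · rw [Finset.card_map, Fin.card_Iic]
    exact Nat.sub_add_cancel h1
  · intro j hj
    obtain ⟨k, hk, rfl⟩ := Finset.mem_map.1 hj
    exact Tuple.monotone_sort s (Finset.mem_Iic.1 hk)

theorem exists_card_omegaSum_le {n p : ℕ} (h1 : 1 ≤ p) (hn : p ≤ n) (s : Fin n → ℝ) :
    ∃ S : Finset (Fin n), S.card = n + 1 - p ∧ ∀ j ∈ S, omegaSum p h1 hn s ≤ s j := by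
  refine ⟨(Finset.Ici (⟨p - 1, by omega⟩ : Fin n)).map (Tuple.sort s).toEmbedding, ?_, ?_⟩
  · rw [Finset.card_map, Fin.card_Ici]
    change n - (p - 1) = n + 1 - p
    omega
  · intro j hj
    obtain ⟨k, hk, rfl⟩ := Finset.mem_map.1 hj
    exact Tuple.monotone_sort s (Finset.mem_Ici.1 hk)

theorem exists_mem_inter {n p : ℕ} (hn : p ≤ n) {S T : Finset (Fin n)}
    (hS : S.card = p) (hT : T.card = n + 1 - p) : ∃ j, j ∈ S ∧ j ∈ T := by
  by_contra! h
  have hd : Disjoint S T := Finset.disjoint_left.2 h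
  have := Finset.card_le_univ (S ∪ T)
  rw [Finset.card_union_of_disjoint hd, Fintype.card_fin] at this
  omega

theorem omegaSum_le_omegaSum_add {n p : ℕ} (h1 : 1 ≤ p) (hn : p ≤ n) {s t : Fin n → ℝ} {c : ℝ}
    (h : ∀ j, s j ≤ t j + c) : omegaSum p h1 hn s ≤ omegaSum p h1 hn t + c := by
  obtain ⟨S, hS, hSt⟩ := exists_card_le_omegaSum h1 hn t
  obtain ⟨T, hT, hTs⟩ := exists_card_omegaSum_le h1 hn s
  obtain ⟨j, hjS, hjT⟩ := exists_mem_inter hn hS hT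
  linarith [h j, hSt j hjS, hTs j hjT]

/-! ### The maxmin-`ω` matrix-vector product -/

theorem omegaMulVec_add_const {n p : ℕ} (h1 : 1 ≤ p) (hn : p ≤ n)
    (A : Matrix (Fin n) (Fin n) ℝ) (x : Fin n → ℝ) (c : ℝ) (i : Fin n) :
    omegaMulVec p h1 hn A (fun j => x j + c) i = omegaMulVec p h1 hn A x i + c := by
  refine le_antisymm (omegaSum_le_omegaSum_add h1 hn fun j => by linarith) ?_
  have := omegaSum_le_omegaSum_add h1 hn (s := fun j => A i j + x j)
    (t := fun j => A i j + (x j + c)) (c := -c) fun j => by linarith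
  unfold omegaMulVec
  linarith

theorem lipschitzWith_omegaMulVec {n p : ℕ} (h1 : 1 ≤ p) (hn : p ≤ n)
    (A : Matrix (Fin n) (Fin n) ℝ) : LipschitzWith 1 (omegaMulVec p h1 hn A) := by
  have key : ∀ (x y : Fin n → ℝ) (i : Fin n),
      omegaMulVec p h1 hn A x i ≤ omegaMulVec p h1 hn A y i + dist x y := fun x y i =>
    omegaSum_le_omegaSum_add h1 hn fun j => by
      have := (le_abs_self (x j - y j)).trans (dist_le_pi_dist x y j)
      linarith
  refine LipschitzWith.of_dist_le_mul fun x y => ?_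
  rw [NNReal.coe_one, one_mul]
  refine (dist_pi_le_iff dist_nonneg).2 fun i => ?_
  rw [Real.dist_eq, abs_le]
  have h := key x y i
  have h' := key y x i
  rw [dist_comm] at h'
  constructor <;> linarith

/-- The image of `x ↦ A ⊗ x` is bounded in the spread seminorm `maxᵢ xᵢ - minₖ xₖ`. -/
theorem exists_omegaMulVec_le_add {n p : ℕ} (h1 : 1 ≤ p) (hn : p ≤ n)
    (A : Matrix (Fin n) (Fin n) ℝ) :
    ∃ B : ℝ, ∀ x i k, omegaMulVec p h1 hn A x i ≤ omegaMulVec p h1 hn A x k + B := by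
  obtain ⟨B, hB⟩ := (Set.finite_range
    fun t : Fin n × Fin n × Fin n => A t.1 t.2.2 - A t.2.1 t.2.2).bddAbove
  refine ⟨B, fun x i k => omegaSum_le_omegaSum_add h1 hn fun j => ?_⟩
  have := hB ⟨(i, k, j), rfl⟩
  dsimp only at this
  linarith

theorem exists_omegaMulVec_smul_eq {n p : ℕ} (h1 : 1 ≤ p) (hn : p ≤ n)
    (A : Matrix (Fin n) (Fin n) ℝ) {α : NNReal} (hα : α < 1) :
    ∃ x : Fin n → ℝ, omegaMulVec p h1 hn A (α • x) = x := by
  have hc : ContractingWith α fun x : Fin n → ℝ => omegaMulVec p h1 hn A (α • x) := by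
    refine ⟨hα, ?_⟩
    have h := (lipschitzWith_omegaMulVec h1 hn A).comp
      (LipschitzWith.of_dist_le_mul (K := α) (f := fun x : Fin n → ℝ => α • x) fun x y => by
        rw [NNReal.smul_def, NNReal.smul_def, dist_smul₀, NNReal.norm_eq])
    rwa [one_mul] at h
  exact ⟨_, hc.fixedPoint_isFixedPt⟩

theorem exists_isEigenvector {n p : ℕ} (h1 : 1 ≤ p) (hn : p ≤ n)
    (A : Matrix (Fin n) (Fin n) ℝ) : ∃ μ x, IsEigenvector p h1 hn A μ x := by
  let o : Fin n := ⟨0, by omega⟩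
  obtain ⟨α, -, hα, hlim⟩ := exists_seq_strictMono_tendsto' (one_pos : (0 : NNReal) < 1)
  choose x hx using fun m => exists_omegaMulVec_smul_eq h1 hn A (hα m).2
  obtain ⟨B, hB⟩ := exists_omegaMulVec_le_add h1 hn A
  let y : ℕ → Fin n → ℝ := fun m j => x m j + -x m o
  have hy : ∀ m, y m ∈ Set.Icc (fun _ => -B) (fun _ => B) := fun m => by
    constructor <;> intro i
    · have := hB (α m • x m) o i
      rw [hx] at this
      change -B ≤ x m i + -x m o
      linarith
    · have := hB (α m • x m) i o
      rw [hx] at this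
      change x m i + -x m o ≤ B
      linarith
  -- Normalising `x m` changes both `f(α x)` and `x` by constants, so `f(α y) - y` is constant.
  have hconst : ∀ m i, omegaMulVec p h1 hn A (α m • y m) i - y m i =
      omegaMulVec p h1 hn A (α m • y m) o - y m o := fun m i => by
    have e : α m • y m = fun j => (α m • x m) j + -(α m * x m o) := by
      funext j
      simp only [y, Pi.smul_apply, NNReal.smul_def, smul_eq_mul]
      ring
    rw [e, omegaMulVec_add_const, omegaMulVec_add_const, hx]
    ring
  obtain ⟨z, -, φ, hφ, hz⟩ := isCompact_Icc.tendsto_subseq hy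
  have hf : Filter.Tendsto (fun m => omegaMulVec p h1 hn A (α (φ m) • y (φ m))) Filter.atTop
      (nhds (omegaMulVec p h1 hn A z)) := by
    have h := ((hlim.comp hφ.tendsto_atTop).smul hz)
    rw [one_smul] at h
    exact ((lipschitzWith_omegaMulVec h1 hn A).continuous.tendsto z).comp h
  refine ⟨omegaMulVec p h1 hn A z o - z o, z, fun i => ?_⟩
  have hl := fun i => (tendsto_pi_nhds.1 hf i).sub (tendsto_pi_nhds.1 hz i)
  have := tendsto_nhds_unique (hl i)
    ((hl o).congr fun m => (hconst (φ m) i).symm)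
  linarith

/-! ### Monotonicity and the upper bound -/

theorem minMaxValue_mono {n : ℕ} {D E : Matrix (Fin n) (Fin n) (WithBot ℝ)}
    (h : ∀ i j, D i j ≤ E i j) (a b : Fin n → ℝ) (r s : ℕ) (hr : r ≤ n) (hs : s ≤ n) :
    minMaxValue D a b r s hr hs ≤ minMaxValue E a b r s hr hs :=
  Finset.inf'_mono_fun fun _ _ => Finset.sup_mono_fun fun ij _ => by
    gcongr
    exact h ij.1 ij.2

theorem minMaxValue_le {n : ℕ} {D : Matrix (Fin n) (Fin n) (WithBot ℝ)} {a b : Fin n → ℝ}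
    {r s : ℕ} (hr : r ≤ n) (hs : s ≤ n) {S T : Finset (Fin n)} (hS : S.card = r)
    (hT : T.card = s) {c : WithBot ℝ}
    (h : ∀ i ∈ S, ∀ j ∈ T, D i j + ((a i - b j : ℝ) : WithBot ℝ) ≤ c) :
    minMaxValue D a b r s hr hs ≤ c := by
  have hmem : (S, T) ∈ Finset.powersetCard r (Finset.univ : Finset (Fin n)) ×ˢ
      Finset.powersetCard s (Finset.univ : Finset (Fin n)) := by
    simp [Finset.mem_powersetCard, hS, hT]
  refine (Finset.inf'_le _ hmem).trans (Finset.sup_le fun ij hij => ?_)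
  exact h _ (Finset.mem_product.1 hij).1 _ (Finset.mem_product.1 hij).2

theorem maxPlusOne_le_minMaxValue {n p : ℕ} (h1 : 1 ≤ p) (hn : p ≤ n)
    (A : Matrix (Fin n) (Fin n) ℝ) (i j : Fin n) :
    maxPlusOne n i j ≤
      minMaxValue (maxPlusOne n) (A i) (A j) p (n + 1 - p) hn (by omega) := by
  by_cases hij : i = j
  · subst hij
    refine Finset.le_inf' _ _ fun S hS => ?_
    obtain ⟨h₁, h₂⟩ := Finset.mem_product.1 hS
    obtain ⟨k, hk₁, hk₂⟩ := exists_mem_inter hn (Finset.mem_powersetCard.1 h₁).2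
      (Finset.mem_powersetCard.1 h₂).2
    have := Finset.le_sup (f := fun ij : Fin n × Fin n =>
      maxPlusOne n ij.1 ij.2 + ((A i ij.1 - A i ij.2 : ℝ) : WithBot ℝ))
      (Finset.mem_product.2 ⟨hk₁, hk₂⟩ : (k, k) ∈ S.1 ×ˢ S.2)
    refine le_trans ?_ this
    simp [maxPlusOne]
  · simp [maxPlusOne, hij]

theorem dbmSeq_le_succ {n p : ℕ} (h1 : 1 ≤ p) (hn : p ≤ n)
    (A : Matrix (Fin n) (Fin n) ℝ) (k : ℕ) (i j : Fin n) :
    dbmSeq A p h1 hn k i j ≤ dbmSeq A p h1 hn (k + 1) i j := by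
  induction k generalizing i j with
  | zero => exact maxPlusOne_le_minMaxValue h1 hn A i j
  | succ k ih => exact minMaxValue_mono ih _ _ _ _ hn (by omega)

theorem dbmSeq_le_dbmOfVec {n p : ℕ} (h1 : 1 ≤ p) (hn : p ≤ n)
    {A : Matrix (Fin n) (Fin n) ℝ} {μ : ℝ} {x : Fin n → ℝ}
    (hx : IsEigenvector p h1 hn A μ x) (k : ℕ) (i j : Fin n) :
    dbmSeq A p h1 hn k i j ≤ dbmOfVec x i j := by
  induction k generalizing i j with
  | zero =>
    by_cases hij : i = j
    · simp [dbmSeq, maxPlusOne, dbmOfVec, hij]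
    · simp [dbmSeq, maxPlusOne, hij]
  | succ k ih =>
    refine (minMaxValue_mono ih _ _ _ _ hn (by omega)).trans ?_
    obtain ⟨S, hS, hSle⟩ := exists_card_le_omegaSum h1 hn fun l => A i l + x l
    obtain ⟨T, hT, hTle⟩ := exists_card_omegaSum_le h1 hn fun l => A j l + x l
    refine minMaxValue_le _ _ hS hT fun a ha b hb => ?_
    have h₁ := hSle a ha
    have h₂ := hTle b hb
    have e₁ := hx i
    have e₂ := hx j
    unfold omegaMulVec at e₁ e₂
    rw [e₁] at h₁
    rw [e₂] at h₂
    change ((x a - x b : ℝ) : WithBot ℝ) + ((A i a - A j b : ℝ) : WithBot ℝ) ≤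
      ((x i - x j : ℝ) : WithBot ℝ)
    rw [← WithBot.coe_add, WithBot.coe_le_coe]
    linarith

/-! ### Stabilisation -/

/-- The set `{-∞} ∪ N⁻¹ℤ`. -/
def botLattice (N : ℕ) : Set (WithBot ℝ) :=
  {d | d = ⊥ ∨ ∃ m : ℤ, d = ((m / N : ℝ) : WithBot ℝ)}

theorem exists_common_denominator {ι : Type*} [Fintype ι] (a : ι → ℝ)
    (ha : ∀ i, ∃ q : ℚ, a i = q) : ∃ N : ℕ, 0 < N ∧ ∀ i, ∃ m : ℤ, a i = m / N := by
  choose q hq using ha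
  have hN : 0 < ∏ i, (q i).den := Finset.prod_pos fun i _ => (q i).den_pos
  refine ⟨∏ i, (q i).den, hN, fun i => ?_⟩
  obtain ⟨c, hc⟩ := Finset.dvd_prod_of_mem (fun i => (q i).den) (Finset.mem_univ i)
  refine ⟨(q i).num * c, ?_⟩
  have hd : ((q i).den : ℝ) ≠ 0 := by exact_mod_cast (q i).den_ne_zero
  have hc0 : (c : ℝ) ≠ 0 := by
    rintro h
    rw [Nat.cast_eq_zero.1 h, mul_zero] at hc
    omega
  rw [hq, hc, Rat.cast_def]
  push_cast
  field_simp

theorem minMaxValue_mem_botLattice {n N : ℕ} {D : Matrix (Fin n) (Fin n) (WithBot ℝ)}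
    {a b : Fin n → ℝ} (hD : ∀ i j, D i j ∈ botLattice N) (ha : ∀ i, ∃ m : ℤ, a i = m / N)
    (hb : ∀ i, ∃ m : ℤ, b i = m / N) (r s : ℕ) (hr : r ≤ n) (hs : s ≤ n) :
    minMaxValue D a b r s hr hs ∈ botLattice N := by
  -- Being a linear order, `WithBot ℝ` has minima and maxima that are attained.
  refine Finset.inf'_mem (botLattice N) (fun u hu v hv => ?_) _ _ _ fun S _ => ?_
  · rcases min_choice u v with h | h
    · exact h.symm ▸ hu
    · exact h.symm ▸ hv
  · refine Finset.sup_induction (Or.inl rfl) (fun u hu v hv => ?_) fun ij _ => ?_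
    · rcases max_choice u v with h | h
      · exact h.symm ▸ hu
      · exact h.symm ▸ hv
    · rcases hD ij.1 ij.2 with h | ⟨m, h⟩
      · exact Or.inl (by rw [h, WithBot.bot_add])
      · obtain ⟨u, hu⟩ := ha ij.1
        obtain ⟨v, hv⟩ := hb ij.2
        refine Or.inr ⟨m + (u - v), ?_⟩
        rw [h, ← WithBot.coe_add, hu, hv, WithBot.coe_inj]
        push_cast
        ring

theorem dbmSeq_mem_botLattice {n p N : ℕ} (h1 : 1 ≤ p) (hn : p ≤ n)
    {A : Matrix (Fin n) (Fin n) ℝ} (hA : ∀ i j, ∃ m : ℤ, A i j = m / N) (k : ℕ) (i j : Fin n) :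
    dbmSeq A p h1 hn k i j ∈ botLattice N := by
  induction k generalizing i j with
  | zero =>
    by_cases hij : i = j
    · exact Or.inr ⟨0, by simp [dbmSeq, maxPlusOne, hij]⟩
    · exact Or.inl (by simp [dbmSeq, maxPlusOne, hij])
  | succ k ih => exact minMaxValue_mem_botLattice ih (hA i) (hA j) _ _ hn (by omega)

theorem finite_botLattice_inter_Icc {N : ℕ} (hN : 0 < N) (a b : ℝ) :
    (botLattice N ∩ Set.Icc (a : WithBot ℝ) b).Finite := by
  refine ((Set.finite_Icc ⌈a * N⌉ ⌊b * N⌋).image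
    fun m : ℤ => ((m / N : ℝ) : WithBot ℝ)).subset ?_
  have hN' : (0 : ℝ) < N := by exact_mod_cast hN
  rintro _ ⟨rfl | ⟨m, rfl⟩, hl, hu⟩
  · exact absurd hl (by simp)
  · rw [WithBot.coe_le_coe] at hl hu
    refine ⟨m, ⟨Int.ceil_le.2 ?_, Int.le_floor.2 ?_⟩, rfl⟩
    · exact (le_div_iff₀ hN').1 hl
    · exact (div_le_iff₀ hN').1 hu

theorem eventually_const_of_monotone_of_mem_botLattice {N : ℕ} (hN : 0 < N)
    {u : ℕ → WithBot ℝ} (hu : Monotone u) (hmem : ∀ k, u k ∈ botLattice N) {b : ℝ}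
    (hb : ∀ k, u k ≤ b) : ∃ K, ∀ k, K ≤ k → u k = u K := by
  by_cases hbot : ∀ k, u k = ⊥
  · exact ⟨0, fun k _ => (hbot k).trans (hbot 0).symm⟩
  push Not at hbot
  -- Once finite, the sequence takes finitely many values; it is constant after the largest.
  obtain ⟨k₀, hk₀⟩ := hbot
  obtain ⟨a, ha⟩ := WithBot.ne_bot_iff_exists.1 hk₀
  have hfin : (u '' Set.Ici k₀).Finite :=
    (finite_botLattice_inter_Icc hN a b).subset <| by
      rintro _ ⟨k, hk, rfl⟩
      exact ⟨hmem k, ha ▸ hu hk, hb k⟩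
  obtain ⟨_, ⟨⟨K, hK, rfl⟩, hmax⟩⟩ := hfin.exists_maximal ⟨_, k₀, Set.self_mem_Ici, rfl⟩
  exact ⟨K, fun k hk => le_antisymm (hmax ⟨k, le_trans hK hk, rfl⟩ (hu hk)) (hu hk)⟩

end MaxminOmega

theorem mainTheorem3 {n : ℕ} (A : Matrix (Fin n) (Fin n) ℝ)
    (hA : ∀ i j, ∃ q : ℚ, A i j = (q : ℝ)) (p : ℕ) (h1 : 1 ≤ p) (hn : p ≤ n) :
    (∀ k i j, MaxminOmega.dbmSeq A p h1 hn k i j ≤ MaxminOmega.dbmSeq A p h1 hn (k + 1) i j) ∧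
    (∃ (μ : ℝ) (x : Fin n → ℝ), MaxminOmega.IsEigenvector p h1 hn A μ x) ∧
    (∀ (μ : ℝ) (x : Fin n → ℝ), MaxminOmega.IsEigenvector p h1 hn A μ x →
      ∀ k i j, MaxminOmega.dbmSeq A p h1 hn k i j ≤ MaxminOmega.dbmOfVec x i j) ∧
    (∃ K : ℕ, ∀ k, K ≤ k →
      MaxminOmega.dbmSeq A p h1 hn k = MaxminOmega.dbmSeq A p h1 hn K) := by
  refine ⟨MaxminOmega.dbmSeq_le_succ h1 hn A, MaxminOmega.exists_isEigenvector h1 hn A,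
    fun μ x hx => MaxminOmega.dbmSeq_le_dbmOfVec h1 hn hx, ?_⟩
  obtain ⟨μ, x, hx⟩ := MaxminOmega.exists_isEigenvector h1 hn A
  obtain ⟨N, hN, hAN⟩ := MaxminOmega.exists_common_denominator
    (fun ij : Fin n × Fin n => A ij.1 ij.2) fun ij => hA ij.1 ij.2
  have hK : ∀ i j, ∃ K, ∀ k, K ≤ k →
      MaxminOmega.dbmSeq A p h1 hn k i j = MaxminOmega.dbmSeq A p h1 hn K i j := fun i j =>
    MaxminOmega.eventually_const_of_monotone_of_mem_botLattice hN
      (u := fun k => MaxminOmega.dbmSeq A p h1 hn k i j)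
      (monotone_nat_of_le_succ fun k => MaxminOmega.dbmSeq_le_succ h1 hn A k i j)
      (fun k => MaxminOmega.dbmSeq_mem_botLattice h1 hn (fun i j => hAN (i, j)) k i j)
      (fun k => MaxminOmega.dbmSeq_le_dbmOfVec h1 hn hx k i j)
  choose K hK using hK
  have hle : ∀ i j, K i j ≤ Finset.univ.sup fun ij : Fin n × Fin n => K ij.1 ij.2 := fun i j =>
    Finset.le_sup (f := fun ij : Fin n × Fin n => K ij.1 ij.2) (Finset.mem_univ (i, j))
  refine ⟨Finset.univ.sup fun ij : Fin n × Fin n => K ij.1 ij.2, fun k hk => ?_⟩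
  ext1 i j
  rw [hK i j k ((hle i j).trans hk), hK i j _ (hle i j)]
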